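/- Let $\Lambda\subset\mathbb{C}$ be open, $X$ a complex Hilbert space and $A(\cdot)\colon\Lambda\to L(X)$ a holomorphic function whose values are bounded Fredholm operators, with non-empty resolvent set $\rho(A(\cdot))=\{\lambda\in\Lambda: A(\lambda)\text{ is invertible}\}$, and put $\sigma(A(\cdot))=\Lambda\setminus\rho(A(\cdot))$. Let $(X_n)_{n\in\mathbb{N}}$ be closed subspaces of $X$ whose orthogonal projections $P_n$ satisfy $\lim_{n\to\infty}\|u-P_nu\|_X=0$ for every $u\in X$, and let $A_n(\lambda):=P_nA(\lambda)|_{X_n}\in L(X_n)$ for $\lambda\in\Lambda$, with $\sigma(A_n(\cdot))$ defined in the same way. Assume that $A_n(\lambda)$ is Fredholm with index zero for all $n\in\mathbb{N}$ and $\lambda\in\Lambda$, and that for each $\lambda\in\Lambda$ the sequence $(A_n(\lambda))_{n\in\mathbb{N}}$ is regular: whenever $u_n\in X_n$ is a bounded sequence such that every subsequence of $(A_n(\lambda)u_n)_{n}$ has a convergent subsequence, then every subsequence of $(u_n)_{n}$ has a convergent subsequence. Let $\tilde\Lambda\subset\Lambda$ be a compact set with $\partial\tilde\Lambda\subset\rho(A(\cdot))$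 and $\tilde\Lambda\cap\sigma(A(\cdot))=\{\lambda_0\}$. Then there exist $n_0\in\mathbb{N}$ and $c>0$ such that for all $n>n_0$, all $\lambda_n\in\sigma(A_n(\cdot))\cap\tilde\Lambda$ and all $u_n\in\ker A_n(\lambda_n)$ with $\|u_n\|_X=1$, $$\inf_{u_0\in\ker A(\lambda_0)}\|u_n-u_0\|_X\le c\Big(|\lambda_n-\lambda_0|+\max_{u_0'\in\ker A(\lambda_0),\ \|u_0'\|_X\le 1}\ \inf_{u_n'\in X_n}\|u_0'-u_n'\|_X\Big).$$ -/

import Mathlib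

open Filter Topology

namespace HolomorphicEVP

section OperatorFunctions

variable {E : Type*} [NormedAddCommGroup E] [NormedSpace ℂ E]

/-- The resolvent set of an operator function on `Λ`: the points of `Λ` at which the operator is
invertible, with bounded inverse. -/
def resolventSet (Λ : Set ℂ) (A : ℂ → E →L[ℂ] E) : Set ℂ :=
  {z | z ∈ Λ ∧ IsUnit (A z)}

/-- The spectrum of an operator function on `Λ`: the complement in `Λ` of the resolvent set. -/
def spectrum (Λ : Set ℂ) (A : ℂ → E →L[ℂ] E) : Set ℂ :=
  Λ \ resolventSet Λ A

/-- A sequence is compact if every subsequence has in turn a converging subsequence. -/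
def IsCompactSeq (u : ℕ → E) : Prop :=
  ∀ φ : ℕ → ℕ, StrictMono φ →
    ∃ ψ : ℕ → ℕ, StrictMono ψ ∧ ∃ x : E, Tendsto (fun k => u (φ (ψ k))) atTop (𝓝 x)

/-- A sequence of bounded operators on the subspaces `Xs n` is regular if for each bounded sequence
`u n ∈ Xs n`, compactness of `B n (u n)` implies compactness of `u n`. Compactness is meant in the
ambient space. -/
def IsRegular (Xs : ℕ → Submodule ℂ E) (B : ∀ n, Xs n →L[ℂ] Xs n) : Prop :=
  ∀ u : ∀ n, Xs n, (∃ C : ℝ, ∀ n, ‖u n‖ ≤ C) →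
    IsCompactSeq (fun n => (B n (u n) : E)) → IsCompactSeq (fun n => (u n : E))

/-- The approximation error of the unit ball of `K` by elements of `Y`, i.e. the supremum of
`dist (u, Y)` over `u ∈ K` with `‖u‖ ≤ 1`. -/
noncomputable def approxError (K Y : Submodule ℂ E) : ℝ :=
  sSup ((fun u : E => Metric.infDist u (Y : Set E)) '' {u : E | u ∈ K ∧ ‖u‖ ≤ 1})

/-- For finite dimensional `K` the supremum in `approxError` is a maximum. -/
theorem approxError_isGreatest (K Y : Submodule ℂ E) [FiniteDimensional ℂ K] :
    IsGreatest ((fun u : E => Metric.infDist u (Y : Set E)) '' {u : E | u ∈ K ∧ ‖u‖ ≤ 1})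
      (approxError K Y) := by
  have hc : IsCompact {u : E | u ∈ K ∧ ‖u‖ ≤ 1} := by
    have : ProperSpace K := FiniteDimensional.proper ℂ K
    have h := (isCompact_closedBall (0 : K) 1).image continuous_subtype_val
    convert h using 1
    ext u
    simp [and_comm]
  exact (hc.image (Metric.continuous_infDist_pt _)).isGreatest_sSup
    ⟨_, ⟨0, ⟨K.zero_mem, by simp⟩, rfl⟩⟩

end OperatorFunctions

/-- The Galerkin approximation `P A|_Y : Y → Y` of a bounded operator `A`, with `P` the orthogonal
projection onto the closed subspace `Y`. -/
noncomputable def galerkin {X : Type*} [NormedAddCommGroup X] [InnerProductSpace ℂ X]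
    (Y : Submodule ℂ X) [Y.HasOrthogonalProjection] (A : X →L[ℂ] X) : Y →L[ℂ] Y :=
  Y.orthogonalProjectionOnto ∘L A ∘L Y.subtypeL

end HolomorphicEVP

/-!
The estimate is a statement about the single operator `A z₀`; the parameter `z` enters only
through `A_n(z) u = 0`, which by differentiability of `A` at `z₀` gives
`‖A_n(z₀) u‖ ≤ L * ‖z - z₀‖` near `z₀`. At a distance `≥ r` from `z₀` there is nothing to prove,
since the left-hand side is at most `‖u‖ = 1 ≤ ‖z - z₀‖ / r`.

Write `K = ker (A z₀)` and let `Q` be the orthogonal projection onto `K`. The crucial point is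
stability of the Galerkin operators away from `K`
(`HolomorphicEVP.exists_norm_le_mul_galerkin_add_starProjection`): for large `n` and all `w ∈ Xs n`,
`‖w‖ ≤ C * (‖A_n(z₀) w‖ + ‖Q w‖)`. Otherwise there would be unit vectors `w_k ∈ Xs (n_k)`, with
`n_k` increasing, along which both terms on the right tend to zero. Regularity makes them converge
along a subsequence. The limit is a unit vector, it lies in `K` because the projections converge
strongly, and `Q` annihilates it, which is absurd.

This is applied to `w = u - P_n Q u`, which differs from `u - Q u` by `Q u - P_n Q u`, a vector of
norm at most the approximation error of `K` by `Xs n`. Since `A Q u = 0`, both `A_n(z₀) w` and `Q w`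
are controlled by `A_n(z₀) u` and that same error.
-/

namespace HolomorphicEVP

variable {X : Type*} [NormedAddCommGroup X] [InnerProductSpace ℂ X]

theorem coe_galerkin_apply (Y : Submodule ℂ X) [Y.HasOrthogonalProjection] (A : X →L[ℂ] X)
    (u : Y) : (galerkin Y A u : X) = Y.starProjection (A u) := rfl

theorem norm_galerkin_apply_le (Y : Submodule ℂ X) [Y.HasOrthogonalProjection] (A : X →L[ℂ] X)
    (u : Y) : ‖galerkin Y A u‖ ≤ ‖A‖ * ‖u‖ := by
  rw [← Submodule.norm_coe, coe_galerkin_apply]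
  exact (Y.norm_starProjection_apply_le _).trans (A.le_opNorm _)

theorem norm_sub_starProjection_eq_infDist (Y : Submodule ℂ X) [Y.HasOrthogonalProjection] (v : X) :
    ‖v - Y.starProjection v‖ = Metric.infDist v (Y : Set X) := by
  rw [Submodule.starProjection_minimal, Metric.infDist_eq_iInf]
  simp only [dist_eq_norm]
  rfl

theorem infDist_le_norm (Y : Submodule ℂ X) (v : X) : Metric.infDist v (Y : Set X) ≤ ‖v‖ := by
  simpa using Metric.infDist_le_dist_of_mem (x := v) Y.zero_mem

theorem infDist_le_approxError {K Y : Submodule ℂ X} {v : X} (hv : v ∈ K) (hv1 : ‖v‖ ≤ 1) :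
    Metric.infDist v (Y : Set X) ≤ approxError K Y := by
  refine le_csSup ⟨1, ?_⟩ ⟨v, ⟨hv, hv1⟩, rfl⟩
  rintro _ ⟨w, ⟨-, hw⟩, rfl⟩
  exact (infDist_le_norm Y w).trans hw

theorem approxError_nonneg (K Y : Submodule ℂ X) : 0 ≤ approxError K Y :=
  Metric.infDist_nonneg.trans (infDist_le_approxError K.zero_mem (by simp))

/-- A limit point of a sequence that is annihilated asymptotically by the Galerkin operators lies in
the kernel, by strong convergence of the projections. -/
theorem apply_eq_zero_of_tendsto_galerkin {Xs : ℕ → Submodule ℂ X}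
    [∀ n, (Xs n).HasOrthogonalProjection]
    (hP : ∀ u : X, Tendsto (fun n => ‖u - (Xs n).starProjection u‖) atTop (𝓝 0))
    (A : X →L[ℂ] X) {u : ∀ n, Xs n}
    (hu : Tendsto (fun n => (galerkin (Xs n) A (u n) : X)) atTop (𝓝 0))
    {χ : ℕ → ℕ} (hχ : StrictMono χ) {x : X}
    (hx : Tendsto (fun k => (u (χ k) : X)) atTop (𝓝 x)) : A x = 0 := by
  have h1 : Tendsto (fun k => (Xs (χ k)).starProjection (A x)) atTop (𝓝 (A x)) := by
    have h0 : Tendsto (fun n => (Xs n).starProjection (A x)) atTop (𝓝 (A x)) :=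
      tendsto_iff_norm_sub_tendsto_zero.2 ((hP (A x)).congr fun n => norm_sub_rev _ _)
    exact h0.comp hχ.tendsto_atTop
  have h2 : Tendsto (fun k => (Xs (χ k)).starProjection (A x - A (u (χ k)))) atTop (𝓝 0) := by
    have h3 : Tendsto (fun k => ‖A x - A (u (χ k))‖) atTop (𝓝 0) := by
      simpa using (((A.continuous.tendsto x).comp hx).const_sub (A x)).norm
    exact squeeze_zero_norm (fun k => Submodule.norm_starProjection_apply_le _ _) h3
  have h4 := h2.add (hu.comp hχ.tendsto_atTop)
  refine tendsto_nhds_unique h1 (Tendsto.congr (fun k => ?_) (by simpa using h4))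
  simp [coe_galerkin_apply]

/-- Stability of the Galerkin operators of a regular approximation, modulo the kernel. -/
theorem exists_norm_le_mul_galerkin_add_starProjection {Xs : ℕ → Submodule ℂ X}
    [∀ n, (Xs n).HasOrthogonalProjection]
    (hP : ∀ u : X, Tendsto (fun n => ‖u - (Xs n).starProjection u‖) atTop (𝓝 0))
    (A : X →L[ℂ] X) [A.ker.HasOrthogonalProjection]
    (hreg : IsRegular Xs (fun n => galerkin (Xs n) A)) :
    ∃ N : ℕ, ∃ C : ℝ, 0 < C ∧ ∀ n > N, ∀ w : Xs n,
      ‖w‖ ≤ C * (‖galerkin (Xs n) A w‖ + ‖A.ker.starProjection w‖) := by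
  by_contra! hcon
  have hfreq : ∀ k : ℕ, ∃ᶠ n in atTop, ∃ w : Xs n, ‖w‖ = 1 ∧
      ‖galerkin (Xs n) A w‖ + ‖A.ker.starProjection (w : X)‖ ≤ 1 / ((k : ℝ) + 1) := by
    refine fun k => frequently_atTop'.2 fun N => ?_
    have hk : (0 : ℝ) < k + 1 := by positivity
    obtain ⟨n, hn, w, hw⟩ := hcon N (k + 1) hk
    have hw0 : 0 < ‖w‖ := lt_of_le_of_lt (by positivity) hw
    refine ⟨n, hn, ((‖w‖⁻¹ : ℝ) : ℂ) • w, ?_, ?_⟩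
    · rw [norm_smul, Complex.norm_real, norm_inv, norm_norm, inv_mul_cancel₀ hw0.ne']
    · rw [map_smul, Submodule.coe_smul, map_smul, norm_smul, norm_smul, Complex.norm_real,
        norm_inv, norm_norm, ← mul_add, inv_mul_eq_div, div_le_div_iff₀ hw0 hk]
      linarith
  obtain ⟨φ, hφ, hw⟩ := extraction_forall_of_frequently hfreq
  choose w hw1 hws using hw
  -- Regularity speaks of full sequences, so the unit vectors are extended by zero off the range
  -- of `φ`.
  have hext : ∀ n, ∃ x : Xs n, ‖x‖ ≤ 1 ∧
      (∀ k, φ k = n → ‖x‖ = 1 ∧ ‖galerkin (Xs n) A x‖ + ‖A.ker.starProjection (x : X)‖ ≤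
        1 / ((k : ℝ) + 1)) ∧ ((∀ k, φ k ≠ n) → x = 0) := by
    intro n
    by_cases h : ∃ k, φ k = n
    · obtain ⟨k, rfl⟩ := h
      refine ⟨w k, (hw1 k).le, fun j hj => ?_, fun h => absurd rfl (h k)⟩
      rw [hφ.injective hj]
      exact ⟨hw1 k, hws k⟩
    · push Not at h
      exact ⟨0, by simp, fun k hk => absurd hk (h k), fun _ => rfl⟩
  choose u hu1 huφ hu0 using hext
  have hgal : Tendsto (fun n => (galerkin (Xs n) A (u n) : X)) atTop (𝓝 0) := by
    rw [Metric.tendsto_atTop]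
    intro ε hε
    obtain ⟨k₀, hk₀⟩ := exists_nat_one_div_lt hε
    refine ⟨φ k₀, fun n hn => ?_⟩
    rw [dist_zero_right, Submodule.norm_coe]
    by_cases h : ∃ k, φ k = n
    · obtain ⟨k, hk⟩ := h
      have hkk : k₀ ≤ k := hφ.le_iff_le.1 (hk ▸ hn)
      have := (huφ n k hk).2
      have := Nat.one_div_le_one_div (α := ℝ) hkk
      have := norm_nonneg (A.ker.starProjection (u n : X))
      linarith
    · push Not at h
      simpa [hu0 n h] using hε
  obtain ⟨ψ, hψ, x, hx⟩ := hreg u ⟨1, hu1⟩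
    (fun χ hχ => ⟨id, strictMono_id, 0, hgal.comp hχ.tendsto_atTop⟩) φ hφ
  have hxK : x ∈ A.ker :=
    apply_eq_zero_of_tendsto_galerkin hP A hgal (hφ.comp hψ) hx
  have hx1 : ‖x‖ = 1 :=
    tendsto_nhds_unique hx.norm
      (tendsto_const_nhds.congr fun k => ((huφ _ _ rfl).1.symm : (1 : ℝ) = ‖u (φ (ψ k))‖))
  have hQ0 : Tendsto (fun k => A.ker.starProjection (u (φ (ψ k)) : X)) atTop (𝓝 0) := by
    refine squeeze_zero_norm (fun k => ?_)
      (tendsto_one_div_add_atTop_nhds_zero_nat.comp hψ.tendsto_atTop)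
    have := (huφ _ _ (rfl : φ (ψ k) = _)).2
    have := norm_nonneg (galerkin (Xs (φ (ψ k))) A (u (φ (ψ k))))
    simp only [Function.comp]
    linarith
  have hQx : A.ker.starProjection x = 0 :=
    tendsto_nhds_unique ((A.ker.starProjection.continuous.tendsto x).comp hx) hQ0
  rw [Submodule.starProjection_eq_self_iff.2 hxK] at hQx
  simp [hQx] at hx1

/-- A stable Galerkin operator controls the distance of unit vectors to the kernel, up to the error
of approximating the kernel. -/
theorem infDist_ker_le_of_stable (Y : Submodule ℂ X) [Y.HasOrthogonalProjection]
    (A : X →L[ℂ] X) [A.ker.HasOrthogonalProjection] {C : ℝ} (hC : 0 ≤ C)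
    (hstab : ∀ w : Y, ‖w‖ ≤ C * (‖galerkin Y A w‖ + ‖A.ker.starProjection w‖))
    {u : Y} (hu : ‖u‖ = 1) :
    Metric.infDist (u : X) (A.ker : Set X) ≤
      C * ‖galerkin Y A u‖ + (C * (‖A‖ + 1) + 1) * approxError A.ker Y := by
  set q : X := A.ker.starProjection (u : X) with hq
  have hqK : q ∈ A.ker := Submodule.starProjection_apply_mem _ _
  have hAq : A q = 0 := hqK
  set δ := approxError A.ker Y
  have hδ : ‖q - Y.starProjection q‖ ≤ δ := by
    rw [norm_sub_starProjection_eq_infDist]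
    refine infDist_le_approxError hqK ?_
    exact (Submodule.norm_starProjection_apply_le _ _).trans hu.le
  set w : Y := u - Y.orthogonalProjectionOnto q
  have hw : (w : X) = (u - q) + (q - Y.starProjection q) := by
    simp [w]
  have hgal : ‖galerkin Y A w‖ ≤ ‖galerkin Y A u‖ + ‖A‖ * δ := by
    have h1 : (galerkin Y A w : X) =
        galerkin Y A u + Y.starProjection (A (q - Y.starProjection q)) := by
      rw [coe_galerkin_apply, coe_galerkin_apply, hw, ← map_add, ← map_add]
      simp [hAq, sub_eq_add_neg]
    rw [← Submodule.norm_coe, h1, ← Submodule.norm_coe (galerkin Y A u)]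
    refine (norm_add_le _ _).trans ?_
    gcongr
    refine (Submodule.norm_starProjection_apply_le _ _).trans ((A.le_opNorm _).trans ?_)
    gcongr
  have hQw : ‖A.ker.starProjection (w : X)‖ ≤ δ := by
    have h1 : A.ker.starProjection ((u : X) - q) = 0 := by
      rw [map_sub, ← hq, Submodule.starProjection_eq_self_iff.2 hqK, sub_self]
    rw [hw, map_add, h1, zero_add]
    exact (Submodule.norm_starProjection_apply_le _ _).trans hδ
  have huq : ‖(u : X) - q‖ ≤ ‖w‖ + δ := by
    have h1 : (u : X) - q = w - (q - Y.starProjection q) := by rw [hw]; abel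
    rw [h1]
    exact (norm_sub_le _ _).trans (by gcongr; exact le_rfl)
  calc Metric.infDist (u : X) (A.ker : Set X) = ‖(u : X) - q‖ :=
        (norm_sub_starProjection_eq_infDist _ _).symm
    _ ≤ C * (‖galerkin Y A w‖ + ‖A.ker.starProjection (w : X)‖) + δ := by
        linarith [hstab w]
    _ ≤ C * (‖galerkin Y A u‖ + ‖A‖ * δ + δ) + δ := by gcongr
    _ = C * ‖galerkin Y A u‖ + (C * (‖A‖ + 1) + 1) * δ := by ring

end HolomorphicEVP

theorem mainTheorem4 {X : Type*} [NormedAddCommGroup X] [InnerProductSpace ℂ X] [CompleteSpace X]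
    -- a holomorphic Fredholm operator function with non-empty resolvent set
    (Λ : Set ℂ) (hΛ : IsOpen Λ) (A : ℂ → X →L[ℂ] X)
    (hA_hol : DifferentiableOn ℂ A Λ)
    (hA_fred : ∀ z ∈ Λ, (A z).IsFredholm)
    (hA_res : (HolomorphicEVP.resolventSet Λ A).Nonempty)
    -- closed subspaces whose orthogonal projections converge pointwise to the identity
    (Xs : ℕ → Submodule ℂ X) [∀ n, CompleteSpace (Xs n)]
    (hP : ∀ u : X, Filter.Tendsto (fun n => ‖u - (Xs n).starProjection u‖) Filter.atTop (nhds 0))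
    -- the Galerkin approximations are Fredholm with index zero and regular
    (hAn_fred : ∀ n, ∀ z ∈ Λ, (HolomorphicEVP.galerkin (Xs n) (A z)).IsFredholm ∧
      (HolomorphicEVP.galerkin (Xs n) (A z)).toLinearMap.index = 0)
    (hAn_reg : ∀ z ∈ Λ, HolomorphicEVP.IsRegular Xs
      (fun n => HolomorphicEVP.galerkin (Xs n) (A z)))
    -- a compact region that isolates the eigenvalue `z₀`
    (Λ' : Set ℂ) (hΛ'_sub : Λ' ⊆ Λ) (hΛ'_compact : IsCompact Λ')
    (hΛ'_bdry : frontier Λ' ⊆ HolomorphicEVP.resolventSet Λ A)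
    (z₀ : ℂ) (hz₀ : Λ' ∩ HolomorphicEVP.spectrum Λ A = {z₀}) :
    ∃ n₀ : ℕ, ∃ c : ℝ, 0 < c ∧ ∀ n > n₀,
      ∀ z ∈ HolomorphicEVP.spectrum Λ (fun w => HolomorphicEVP.galerkin (Xs n) (A w)) ∩ Λ',
      ∀ u : Xs n, HolomorphicEVP.galerkin (Xs n) (A z) u = 0 → ‖u‖ = 1 →
        Metric.infDist (u : X) ((A z₀).ker : Set X) ≤
          c * (‖z - z₀‖ + HolomorphicEVP.approxError (A z₀).ker (Xs n)) := by
  have hz₀Λ : z₀ ∈ Λ := hΛ'_sub (hz₀.symm.subset rfl).1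
  obtain ⟨N, C, hC, hstab⟩ :=
    HolomorphicEVP.exists_norm_le_mul_galerkin_add_starProjection hP (A z₀) (hAn_reg z₀ hz₀Λ)
  obtain ⟨L, hL, hLip⟩ :=
    (hA_hol.differentiableAt (hΛ.mem_nhds hz₀Λ)).isBigO_sub.exists_pos
  obtain ⟨r, hr, hball⟩ := Metric.eventually_nhds_iff.1 hLip.bound
  refine ⟨N, C * L + (C * (‖A z₀‖ + 1) + 1) + 1 / r, by positivity, ?_⟩
  intro n hn z _ u hzu hu
  have hδ := HolomorphicEVP.approxError_nonneg (A z₀).ker (Xs n)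
  set δ := HolomorphicEVP.approxError (A z₀).ker (Xs n)
  have hd := norm_nonneg (z - z₀)
  rcases lt_or_ge ‖z - z₀‖ r with hzr | hzr
  · have hgal : ‖HolomorphicEVP.galerkin (Xs n) (A z₀) u‖ ≤ L * ‖z - z₀‖ := by
      have h1 : HolomorphicEVP.galerkin (Xs n) (A z₀) u =
          -HolomorphicEVP.galerkin (Xs n) (A z - A z₀) u := by
        have h2 : HolomorphicEVP.galerkin (Xs n) (A z - A z₀) u =
            HolomorphicEVP.galerkin (Xs n) (A z) u -
              HolomorphicEVP.galerkin (Xs n) (A z₀) u := by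
          simp [HolomorphicEVP.galerkin]
        rw [h2, hzu, zero_sub, neg_neg]
      rw [h1, norm_neg]
      refine (HolomorphicEVP.norm_galerkin_apply_le _ _ _).trans ?_
      rw [hu, mul_one]
      exact hball (by rwa [dist_eq_norm])
    have hmain := HolomorphicEVP.infDist_ker_le_of_stable (Xs n) (A z₀) hC.le (hstab n hn) hu
    calc Metric.infDist (u : X) ((A z₀).ker : Set X)
        ≤ C * (L * ‖z - z₀‖) + (C * (‖A z₀‖ + 1) + 1) * δ := hmain.trans (by gcongr)
      _ = (C * L) * ‖z - z₀‖ + (C * (‖A z₀‖ + 1) + 1) * δ := by ring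
      _ ≤ (C * L + (C * (‖A z₀‖ + 1) + 1) + 1 / r) * ‖z - z₀‖ +
          (C * L + (C * (‖A z₀‖ + 1) + 1) + 1 / r) * δ := by
          have h1 : 0 < C * L := by positivity
          have h2 : 0 < C * (‖A z₀‖ + 1) + 1 := by positivity
          have h3 : 0 < 1 / r := by positivity
          exact add_le_add (mul_le_mul_of_nonneg_right (by linarith) hd)
            (mul_le_mul_of_nonneg_right (by linarith) hδ)
      _ = _ := by ring
  · calc Metric.infDist (u : X) ((A z₀).ker : Set X) ≤ 1 :=
          (HolomorphicEVP.infDist_le_norm _ _).trans hu.le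
      _ ≤ 1 / r * ‖z - z₀‖ := by
          rw [one_div, inv_mul_eq_div]
          exact (one_le_div hr).2 hzr
      _ ≤ _ := by
          gcongr
          · exact le_add_of_nonneg_left (by positivity)
          · exact le_add_of_nonneg_right hδ
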